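/- For real $q\neq 1$ let $\log_q x=\frac{x^{q-1}-1}{q-1}$ for $x>0$, and let $\exp_q$ denote its inverse function, $\exp_q x=(x(q-1)+1)^{1/(q-1)}$, defined for real $x$ with $x(q-1)+1>0$ (for $q<1$ this means $x<-1/(q-1)$). For Hermitian matrices with spectrum in the respective domain, these functions are applied through the functional calculus. Let $0\le q<1$ and let $H_1,\dots,H_k$ be complex matrices, $H_i$ of size $n_i\times m$, with $H_1^*H_1+\cdots+H_k^*H_k=1$. Then for all positive definite complex matrices $A_1,\dots,A_k$, with $A_i$ of size $n_i\times n_i$, the matrix $\sum_{i=1}^k H_i^*\log_q(A_i)H_i$ is Hermitian with spectrum in the domain of $\exp_q$, and the function $$\varphi(A_1,\dots,A_k)=\operatorname{Tr}\exp_q\Big(\sum_{i=1}^k H_i^*\log_q(A_i)H_i\Big)$$ so defined on $k$-tuples of positive definite matrices is concave, i.e. jointly concave in $(A_1,\dots,A_k)$. -/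

import Mathlib

open scoped Matrix ComplexOrder

/-- The deformed logarithm `log_q`, meant on the positive reals. -/
noncomputable def qLog (q x : ℝ) : ℝ :=
  if q = 1 then Real.log x else (x ^ (q - 1) - 1) / (q - 1)

/-- The set on which the deformed exponential `exp_q` is defined: the reals `x` with
`x > -1/(q-1)` if `q > 1`, with `x < -1/(q-1)` if `q < 1`, and all reals if `q = 1`. -/
def qExpDomain (q : ℝ) : Set ℝ :=
  {x | (1 < q → -1 / (q - 1) < x) ∧ (q < 1 → x < -1 / (q - 1))}

/-- The deformed exponential `exp_q`, meant on `qExpDomain q`. -/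
noncomputable def qExp (q x : ℝ) : ℝ :=
  if q = 1 then Real.exp x else (x * (q - 1) + 1) ^ (1 / (q - 1))

/-- The matrix `∑ i, H_i^* log_q(A_i) H_i`; here `log_q(A_i)` is given by the functional
calculus of Hermitian matrices. -/
noncomputable def qLogSum {k : ℕ} {n : Fin k → Type*} {m : Type*}
    [∀ i, Fintype (n i)] [∀ i, DecidableEq (n i)]
    (q : ℝ) (H : ∀ i, Matrix (n i) m ℂ) (A : ∀ i, Matrix (n i) (n i) ℂ) : Matrix m m ℂ :=
  ∑ i, (H i)ᴴ * cfc (qLog q) (A i) * H i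

/-- The function `φ(A_1, …, A_k) = Tr exp_q (∑ i, H_i^* log_q(A_i) H_i)`. The trace of a Hermitian
matrix is real, and `re` reads it as a real number. -/
noncomputable def qTraceFun {k : ℕ} {n : Fin k → Type*} {m : Type*}
    [∀ i, Fintype (n i)] [∀ i, DecidableEq (n i)] [Fintype m] [DecidableEq m]
    (q : ℝ) (H : ∀ i, Matrix (n i) m ℂ) (A : ∀ i, Matrix (n i) (n i) ℂ) : ℝ :=
  (Matrix.trace (cfc (qExp q) (qLogSum q H A))).re

/-! Put `p = 1 - q`, so `0 < p ≤ 1`. Since `∑ H_i^* H_i = 1`, the trace function is `Tr X^(-1/p)`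
with `X = ∑ H_i^* A_i^(-p) H_i`. Moreover `Tr X^(-1/p)` is the maximum over positive definite `Z` of
`(1 + 1/p) Tr Z - (1/p) Tr X Z^(1+p)`. If this expression is jointly concave in `(A, Z)`, its
maximum over `Z` is concave in `A`. Joint concavity is Ando's theorem that `Tr K^* A^(-p) K Z^(1+p)`
is jointly convex (`spectralSum_rpow_convex`). In the eigenbases of `A` and `Z` this trace is a
weighted sum of `a^(-p) z^(1+p)`, which is an integral of kernels `z² / (t a + z)`. Each kernel
gives a jointly convex sum, a maximum over `W` of functionals affine in `(A, Z)`
(`spectralSum_sq_div_convex`). -/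

namespace Matrix

/-! ### Spectral sums and their affine minorants -/

variable {m n : Type*} [Fintype m] [Fintype n]

/-- For fixed `W`, a functional that is affine in `(A, Z)`. -/
noncomputable def fractionalMinorant (t r : ℝ) (W K : Matrix n m ℂ) (A : Matrix n n ℂ)
    (Z : Matrix m m ℂ) : ℝ :=
  2 * (trace (Wᴴ * (K * Z))).re - t * (trace (Wᴴ * (A * W))).re - r * (trace (Wᴴ * (W * Z))).re

theorem fractionalMinorant_add_smul (t r : ℝ) (W K : Matrix n m ℂ) (A B : Matrix n n ℂ)
    (Z Y : Matrix m m ℂ) (u v : ℝ) :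
    fractionalMinorant t r W K (u • A + v • B) (u • Z + v • Y) =
      u * fractionalMinorant t r W K A Z + v * fractionalMinorant t r W K B Y := by
  simp only [fractionalMinorant, Matrix.mul_add, Matrix.add_mul, Matrix.mul_smul, Matrix.smul_mul,
    trace_add, trace_smul, Complex.add_re, Complex.real_smul, Complex.re_ofReal_mul]
  ring

variable [DecidableEq m] [DecidableEq n]

/-- The entries of `K` in the eigenbases of the Hermitian matrices `A` and `Z`. -/
noncomputable def eigenEntries {A : Matrix n n ℂ} {Z : Matrix m m ℂ} (hA : A.IsHermitian)
    (hZ : Z.IsHermitian) (K : Matrix n m ℂ) : Matrix n m ℂ :=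
  (hA.eigenvectorUnitary : Matrix n n ℂ)ᴴ * K * (hZ.eigenvectorUnitary : Matrix m m ℂ)

theorem conjTranspose_mul_eigenvectorUnitary {A : Matrix n n ℂ} (hA : A.IsHermitian) :
    (hA.eigenvectorUnitary : Matrix n n ℂ)ᴴ * (hA.eigenvectorUnitary : Matrix n n ℂ) = 1 :=
  Unitary.coe_star_mul_self hA.eigenvectorUnitary

theorem exists_eigenEntries_eq {A : Matrix n n ℂ} {Z : Matrix m m ℂ} (hA : A.IsHermitian)
    (hZ : Z.IsHermitian) (C : Matrix n m ℂ) : ∃ W, eigenEntries hA hZ W = C := by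
  refine ⟨(hA.eigenvectorUnitary : Matrix n n ℂ) * C * (hZ.eigenvectorUnitary : Matrix m m ℂ)ᴴ, ?_⟩
  calc _ = ((hA.eigenvectorUnitary : Matrix n n ℂ)ᴴ * (hA.eigenvectorUnitary : Matrix n n ℂ)) * C *
        ((hZ.eigenvectorUnitary : Matrix m m ℂ)ᴴ * (hZ.eigenvectorUnitary : Matrix m m ℂ)) := by
        simp only [eigenEntries, Matrix.mul_assoc]
    _ = C := by
        rw [conjTranspose_mul_eigenvectorUnitary, conjTranspose_mul_eigenvectorUnitary,
          Matrix.one_mul, Matrix.mul_one]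

theorem cfc_eq_mul_diagonal_mul {A : Matrix n n ℂ} (hA : A.IsHermitian) (f : ℝ → ℝ) :
    cfc f A = (hA.eigenvectorUnitary : Matrix n n ℂ) *
      diagonal (fun i => (f (hA.eigenvalues i) : ℂ)) *
      (hA.eigenvectorUnitary : Matrix n n ℂ)ᴴ := by
  rw [hA.cfc_eq, IsHermitian.cfc, Unitary.conjStarAlgAut_apply]
  rfl

theorem trace_conjTranspose_mul_cfc_mul_cfc {A : Matrix n n ℂ} {Z : Matrix m m ℂ}
    (hA : A.IsHermitian) (hZ : Z.IsHermitian) (W K : Matrix n m ℂ) (g f : ℝ → ℝ) :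
    trace (Wᴴ * (cfc g A * K * cfc f Z)) =
      ∑ j, ∑ i, star (eigenEntries hA hZ W i j) * eigenEntries hA hZ K i j *
        ((g (hA.eigenvalues i) * f (hZ.eigenvalues j) : ℝ) : ℂ) := by
  have h : trace (Wᴴ * (cfc g A * K * cfc f Z)) = trace ((eigenEntries hA hZ W)ᴴ *
      (diagonal (fun i => (g (hA.eigenvalues i) : ℂ)) * eigenEntries hA hZ K *
        diagonal (fun i => (f (hZ.eigenvalues i) : ℂ)))) := by
    rw [cfc_eq_mul_diagonal_mul hA, cfc_eq_mul_diagonal_mul hZ]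
    simp only [eigenEntries, conjTranspose_mul, conjTranspose_conjTranspose, Matrix.mul_assoc]
    rw [trace_mul_comm (hZ.eigenvectorUnitary : Matrix m m ℂ)ᴴ]
    simp only [Matrix.mul_assoc]
  rw [h, trace]
  refine Finset.sum_congr rfl fun j _ => ?_
  rw [diag_apply, mul_apply]
  refine Finset.sum_congr rfl fun i _ => ?_
  rw [mul_diagonal, diagonal_mul, conjTranspose_apply]
  push_cast
  ring

/-- The weighted sum `∑ |k i j|² F (a i) (z j)` over the eigenvalues `a` of `A` and `z` of `Z`, where
`k` is `K` written in the eigenbases. -/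
noncomputable def spectralSum {A : Matrix n n ℂ} {Z : Matrix m m ℂ} (hA : A.IsHermitian)
    (hZ : Z.IsHermitian) (K : Matrix n m ℂ) (F : ℝ → ℝ → ℝ) : ℝ :=
  ∑ j, ∑ i, Complex.normSq (eigenEntries hA hZ K i j) * F (hA.eigenvalues i) (hZ.eigenvalues j)

theorem re_trace_conjTranspose_mul_cfc_mul_cfc {A : Matrix n n ℂ} {Z : Matrix m m ℂ}
    (hA : A.IsHermitian) (hZ : Z.IsHermitian) (K : Matrix n m ℂ) (g f : ℝ → ℝ) :
    (trace (Kᴴ * (cfc g A * K * cfc f Z))).re = spectralSum hA hZ K fun a z => g a * f z := by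
  rw [trace_conjTranspose_mul_cfc_mul_cfc hA hZ, spectralSum, Complex.re_sum]
  refine Finset.sum_congr rfl fun j _ => ?_
  rw [Complex.re_sum]
  refine Finset.sum_congr rfl fun i _ => ?_
  rw [Complex.re_mul_ofReal, Complex.star_def, ← Complex.normSq_eq_conj_mul_self, Complex.ofReal_re]

theorem spectralSum_mono {A : Matrix n n ℂ} {Z : Matrix m m ℂ} (hA : A.PosDef)
    (hZ : Z.PosDef) (K : Matrix n m ℂ) {F G : ℝ → ℝ → ℝ}
    (h : ∀ a z, 0 < a → 0 < z → F a z ≤ G a z) :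
    spectralSum hA.1 hZ.1 K F ≤ spectralSum hA.1 hZ.1 K G :=
  Finset.sum_le_sum fun _ _ => Finset.sum_le_sum fun _ _ =>
    mul_le_mul_of_nonneg_left (h _ _ (hA.eigenvalues_pos _) (hZ.eigenvalues_pos _))
      (Complex.normSq_nonneg _)

theorem spectralSum_congr {A : Matrix n n ℂ} {Z : Matrix m m ℂ} (hA : A.PosDef)
    (hZ : Z.PosDef) (K : Matrix n m ℂ) {F G : ℝ → ℝ → ℝ}
    (h : ∀ a z, 0 < a → 0 < z → F a z = G a z) :
    spectralSum hA.1 hZ.1 K F = spectralSum hA.1 hZ.1 K G :=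
  le_antisymm (spectralSum_mono hA hZ K fun a z ha hz => (h a z ha hz).le)
    (spectralSum_mono hA hZ K fun a z ha hz => (h a z ha hz).ge)

theorem spectralSum_const_mul {A : Matrix n n ℂ} {Z : Matrix m m ℂ} (hA : A.IsHermitian)
    (hZ : Z.IsHermitian) (K : Matrix n m ℂ) (c : ℝ) (F : ℝ → ℝ → ℝ) :
    spectralSum hA hZ K (fun a z => c * F a z) = c * spectralSum hA hZ K F := by
  simp only [spectralSum, Finset.mul_sum]
  exact Finset.sum_congr rfl fun _ _ => Finset.sum_congr rfl fun _ _ => by ring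

theorem spectralSum_add {A : Matrix n n ℂ} {Z : Matrix m m ℂ} (hA : A.IsHermitian)
    (hZ : Z.IsHermitian) (K : Matrix n m ℂ) (F G : ℝ → ℝ → ℝ) :
    spectralSum hA hZ K (fun a z => F a z + G a z) =
      spectralSum hA hZ K F + spectralSum hA hZ K G := by
  simp only [spectralSum, ← Finset.sum_add_distrib, mul_add]

/-- In the eigenbases the optimization over `W` decouples into one scalar problem per entry. -/
theorem fractionalMinorant_eq_sum {A : Matrix n n ℂ} {Z : Matrix m m ℂ} (hA : A.IsHermitian)
    (hZ : Z.IsHermitian) (t r : ℝ) (W K : Matrix n m ℂ) :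
    fractionalMinorant t r W K A Z = ∑ j, ∑ i,
      (2 * (star (eigenEntries hA hZ W i j) * eigenEntries hA hZ K i j).re * hZ.eigenvalues j -
        Complex.normSq (eigenEntries hA hZ W i j) *
          (t * hA.eigenvalues i + r * hZ.eigenvalues j)) := by
  have e1 := trace_conjTranspose_mul_cfc_mul_cfc hA hZ W K (fun _ => 1) (fun x => x)
  have e2 := re_trace_conjTranspose_mul_cfc_mul_cfc hA hZ W (fun x => x) (fun _ => 1)
  have e3 := re_trace_conjTranspose_mul_cfc_mul_cfc hA hZ W (fun _ => 1) (fun x => x)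
  rw [cfc_const_one ℝ A hA.isSelfAdjoint, cfc_id' ℝ Z hZ.isSelfAdjoint, Matrix.one_mul] at e1 e3
  rw [cfc_const_one ℝ Z hZ.isSelfAdjoint, cfc_id' ℝ A hA.isSelfAdjoint, Matrix.mul_one] at e2
  rw [fractionalMinorant, e1, e2, e3]
  simp only [spectralSum, Complex.re_sum, Complex.re_mul_ofReal, Finset.mul_sum,
    ← Finset.sum_sub_distrib]
  exact Finset.sum_congr rfl fun _ _ => Finset.sum_congr rfl fun _ _ => by ring

/-- Completing the square: `d |w - (z/d) k|² ≥ 0`, with equality at `w = (z/d) k`. -/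
theorem two_mul_re_sub_le (w k : ℂ) {z d : ℝ} (hd : 0 < d) :
    2 * (star w * k).re * z - Complex.normSq w * d ≤ Complex.normSq k * (z ^ 2 / d) := by
  rw [mul_div_assoc', le_div_iff₀ hd]
  simp only [Complex.star_def, Complex.mul_re, Complex.conj_re, Complex.conj_im,
    Complex.normSq_apply]
  nlinarith [sq_nonneg (w.re * d - k.re * z), sq_nonneg (w.im * d - k.im * z)]

theorem fractionalMinorant_le {A : Matrix n n ℂ} {Z : Matrix m m ℂ} (hA : A.PosDef)
    (hZ : Z.PosDef) {t r : ℝ} (ht : 0 < t) (hr : 0 ≤ r) (W K : Matrix n m ℂ) :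
    fractionalMinorant t r W K A Z ≤
      spectralSum hA.1 hZ.1 K fun a z => z ^ 2 / (t * a + r * z) := by
  rw [fractionalMinorant_eq_sum hA.1 hZ.1]
  refine Finset.sum_le_sum fun j _ => Finset.sum_le_sum fun i _ => two_mul_re_sub_le _ _ ?_
  have := hA.eigenvalues_pos i
  have := hZ.eigenvalues_pos j
  positivity

theorem exists_fractionalMinorant_eq {A : Matrix n n ℂ} {Z : Matrix m m ℂ} (hA : A.PosDef)
    (hZ : Z.PosDef) {t r : ℝ} (ht : 0 < t) (hr : 0 ≤ r) (K : Matrix n m ℂ) :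
    ∃ W, fractionalMinorant t r W K A Z =
      spectralSum hA.1 hZ.1 K fun a z => z ^ 2 / (t * a + r * z) := by
  -- Each entry is the equality case `w = (z/d) k` of the completed square.
  obtain ⟨W, hW⟩ := exists_eigenEntries_eq hA.1 hZ.1 (of fun i j => eigenEntries hA.1 hZ.1 K i j *
    ((hZ.1.eigenvalues j / (t * hA.1.eigenvalues i + r * hZ.1.eigenvalues j) : ℝ) : ℂ))
  refine ⟨W, ?_⟩
  rw [fractionalMinorant_eq_sum hA.1 hZ.1, hW, spectralSum]
  refine Finset.sum_congr rfl fun j _ => Finset.sum_congr rfl fun i _ => ?_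
  have ha := hA.eigenvalues_pos i
  have hz := hZ.eigenvalues_pos j
  have hd : 0 < t * hA.1.eigenvalues i + r * hZ.1.eigenvalues j := by positivity
  simp only [of_apply, star_mul', Complex.star_def, Complex.conj_ofReal, Complex.normSq_mul,
    Complex.normSq_ofReal]
  rw [mul_right_comm (starRingEnd ℂ _), ← Complex.normSq_eq_conj_mul_self,
    Complex.re_mul_ofReal, Complex.ofReal_re]
  field_simp
  ring

/-! ### Ando's convexity theorem -/

/-- Joint convexity of the spectral sum of `z² / (t a + r z)`. -/
theorem spectralSum_sq_div_convex {A B : Matrix n n ℂ} {Z Y : Matrix m m ℂ} (hA : A.PosDef)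
    (hB : B.PosDef) (hZ : Z.PosDef) (hY : Y.PosDef) {t r : ℝ} (ht : 0 < t) (hr : 0 ≤ r)
    {u v : ℝ} (hu : 0 ≤ u) (hv : 0 ≤ v) (hAB : (u • A + v • B).PosDef)
    (hZY : (u • Z + v • Y).PosDef) (K : Matrix n m ℂ) :
    (spectralSum hAB.1 hZY.1 K fun a z => z ^ 2 / (t * a + r * z)) ≤
      u * (spectralSum hA.1 hZ.1 K fun a z => z ^ 2 / (t * a + r * z)) +
      v * (spectralSum hB.1 hY.1 K fun a z => z ^ 2 / (t * a + r * z)) := by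
  obtain ⟨W, hW⟩ := exists_fractionalMinorant_eq hAB hZY ht hr K
  rw [← hW, fractionalMinorant_add_smul]
  gcongr
  · exact fractionalMinorant_le hA hZ ht hr W K
  · exact fractionalMinorant_le hB hY ht hr W K

-- Write `a^(-p) z^(1+p) = z (z/a)^p` and insert `x = z/a` in the integral representation of `x^p`.
open MeasureTheory Set in
theorem exists_measure_rpow_mul_rpow_neg {p : ℝ} (hp : p ∈ Ioo (0 : ℝ) 1) :
    ∃ μ : Measure ℝ, ∀ a z : ℝ, 0 < a → 0 < z →
      IntegrableOn (fun t => t ^ (p - 1) * (z ^ 2 / (t * a + 1 * z))) (Ioi 0) μ ∧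
      a ^ (-p) * z ^ (1 + p) = ∫ t in Ioi 0, t ^ (p - 1) * (z ^ 2 / (t * a + 1 * z)) ∂μ := by
  obtain ⟨μ, hμ⟩ := Real.exists_measure_rpow_eq_integral_rpowIntegrand₀₁ hp
  refine ⟨μ, fun a z ha hz => ?_⟩
  obtain ⟨h1, h2⟩ := hμ (z / a) (div_nonneg hz.le ha.le)
  have key : EqOn (fun t => z * Real.rpowIntegrand₀₁ p t (z / a))
      (fun t => t ^ (p - 1) * (z ^ 2 / (t * a + 1 * z))) (Ioi 0) := by
    intro t ht
    have ht : 0 < t := ht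
    simp only
    rw [Real.rpowIntegrand₀₁_eq_pow_div hp ht.le (div_nonneg hz.le ha.le)]
    field_simp
  refine ⟨(integrableOn_congr_fun key measurableSet_Ioi).1 (h1.const_mul z), ?_⟩
  rw [← setIntegral_congr_fun measurableSet_Ioi key, integral_const_mul, ← h2,
    Real.div_rpow hz.le ha.le, Real.rpow_neg ha.le, Real.rpow_add hz, Real.rpow_one]
  field_simp

/-- **Ando's convexity theorem** for the exponents `-p` and `1 + p`, in spectral form. -/
theorem spectralSum_rpow_convex {A B : Matrix n n ℂ} {Z Y : Matrix m m ℂ} (hA : A.PosDef)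
    (hB : B.PosDef) (hZ : Z.PosDef) (hY : Y.PosDef) {p : ℝ} (hp0 : 0 < p) (hp1 : p ≤ 1)
    {u v : ℝ} (hu : 0 ≤ u) (hv : 0 ≤ v) (hAB : (u • A + v • B).PosDef)
    (hZY : (u • Z + v • Y).PosDef) (K : Matrix n m ℂ) :
    (spectralSum hAB.1 hZY.1 K fun a z => a ^ (-p) * z ^ (1 + p)) ≤
      u * (spectralSum hA.1 hZ.1 K fun a z => a ^ (-p) * z ^ (1 + p)) +
      v * (spectralSum hB.1 hY.1 K fun a z => a ^ (-p) * z ^ (1 + p)) := by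
  rcases hp1.eq_or_lt with rfl | hp1
  · have e : ∀ a z : ℝ, 0 < a → 0 < z →
        a ^ (-1 : ℝ) * z ^ (1 + 1 : ℝ) = z ^ 2 / (1 * a + 0 * z) := by
      intro a z ha hz
      rw [Real.rpow_neg_one, one_add_one_eq_two, Real.rpow_two]
      field_simp
      ring
    rw [spectralSum_congr hAB hZY K e, spectralSum_congr hA hZ K e, spectralSum_congr hB hY K e]
    exact spectralSum_sq_div_convex hA hB hZ hY one_pos le_rfl hu hv hAB hZY K
  · obtain ⟨μ, hμ⟩ := exists_measure_rpow_mul_rpow_neg ⟨hp0, hp1⟩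
    have rep : ∀ {A : Matrix n n ℂ} {Z : Matrix m m ℂ} (hA : A.PosDef) (hZ : Z.PosDef),
        MeasureTheory.IntegrableOn (fun t => t ^ (p - 1) *
          spectralSum hA.1 hZ.1 K fun a z => z ^ 2 / (t * a + 1 * z)) (Set.Ioi 0) μ ∧
        (spectralSum hA.1 hZ.1 K fun a z => a ^ (-p) * z ^ (1 + p)) =
          ∫ t in Set.Ioi 0, t ^ (p - 1) *
            (spectralSum hA.1 hZ.1 K fun a z => z ^ 2 / (t * a + 1 * z)) ∂μ := by
      intro A Z hA hZ
      have hi := fun i j => (hμ _ _ (hA.eigenvalues_pos i) (hZ.eigenvalues_pos j)).1.const_mul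
        (Complex.normSq (eigenEntries hA.1 hZ.1 K i j))
      simp only [← spectralSum_const_mul]
      unfold spectralSum
      refine ⟨MeasureTheory.integrable_finsetSum _ fun j _ =>
        MeasureTheory.integrable_finsetSum _ fun i _ => hi i j, ?_⟩
      rw [MeasureTheory.integral_finsetSum _ fun j _ =>
        MeasureTheory.integrable_finsetSum _ fun i _ => hi i j]
      refine Finset.sum_congr rfl fun j _ => ?_
      rw [MeasureTheory.integral_finsetSum _ fun i _ => hi i j]
      refine Finset.sum_congr rfl fun i _ => ?_
      beta_reduce
      rw [MeasureTheory.integral_const_mul,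
        (hμ _ _ (hA.eigenvalues_pos i) (hZ.eigenvalues_pos j)).2]
    rw [(rep hAB hZY).2, (rep hA hZ).2, (rep hB hY).2, ← MeasureTheory.integral_const_mul,
      ← MeasureTheory.integral_const_mul, ← MeasureTheory.integral_add
        ((rep hA hZ).1.const_mul u) ((rep hB hY).1.const_mul v)]
    refine MeasureTheory.setIntegral_mono_on (rep hAB hZY).1
      (((rep hA hZ).1.const_mul u).add ((rep hB hY).1.const_mul v)) measurableSet_Ioi fun t ht => ?_
    have ht : 0 < t := ht
    calc _ ≤ t ^ (p - 1) * _ := mul_le_mul_of_nonneg_left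
          (spectralSum_sq_div_convex hA hB hZ hY ht zero_le_one hu hv hAB hZY K) (by positivity)
      _ = _ := by ring

/-! ### The variational formula for negative powers -/

theorem one_add_mul_le_rpow_neg_add {p x z : ℝ} (hp : 0 < p) (hx : 0 < x) (hz : 0 < z) :
    (1 + p⁻¹) * z ≤ x ^ (-p⁻¹) + p⁻¹ * (x * z ^ (1 + p)) := by
  -- The weights make `x` cancel in the geometric mean and leave `z` with exponent 1.
  have h := Real.geom_mean_le_arith_mean2_weighted (w₁ := p / (1 + p)) (w₂ := 1 / (1 + p))
    (p₁ := x ^ (-p⁻¹)) (p₂ := x * z ^ (1 + p)) (by positivity) (by positivity) (by positivity)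
    (by positivity) (by field_simp; ring)
  have e : (x ^ (-p⁻¹)) ^ (p / (1 + p)) * (x * z ^ (1 + p)) ^ (1 / (1 + p)) = z := by
    rw [Real.mul_rpow hx.le (by positivity), ← Real.rpow_mul hx.le, ← Real.rpow_mul hz.le,
      ← mul_assoc, ← Real.rpow_add hx]
    have e1 : -p⁻¹ * (p / (1 + p)) + 1 / (1 + p) = 0 := by field_simp; ring
    have e2 : (1 + p) * (1 / (1 + p)) = 1 := by field_simp
    rw [e1, e2, Real.rpow_zero, Real.rpow_one, one_mul]
  rw [e] at h
  have h2 := mul_le_mul_of_nonneg_left h (show 0 ≤ 1 + p⁻¹ by positivity)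
  refine h2.trans (le_of_eq ?_)
  field_simp
  ring

/-- Variational lower bound for `Tr X ^ (-1/p)`. -/
theorem re_trace_le_re_trace_cfc_rpow_neg {X Z : Matrix m m ℂ} (hX : X.PosDef) (hZ : Z.PosDef)
    {p : ℝ} (hp : 0 < p) :
    (1 + p⁻¹) * (trace Z).re - p⁻¹ * (trace (X * cfc (fun z : ℝ => z ^ (1 + p)) Z)).re ≤
      (trace (cfc (fun x : ℝ => x ^ (-p⁻¹)) X)).re := by
  have e1 := re_trace_conjTranspose_mul_cfc_mul_cfc hX.1 hZ.1 1 (fun _ => 1) (fun x => x)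
  have e2 := re_trace_conjTranspose_mul_cfc_mul_cfc hX.1 hZ.1 1 (fun x => x)
    (fun z : ℝ => z ^ (1 + p))
  have e3 := re_trace_conjTranspose_mul_cfc_mul_cfc hX.1 hZ.1 1 (fun x : ℝ => x ^ (-p⁻¹))
    (fun _ => 1)
  simp only [cfc_const_one ℝ X hX.1.isSelfAdjoint, cfc_id' ℝ Z hZ.1.isSelfAdjoint,
    cfc_const_one ℝ Z hZ.1.isSelfAdjoint, cfc_id' ℝ X hX.1.isSelfAdjoint, conjTranspose_one,
    one_mul, mul_one] at e1 e2 e3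
  rw [e1, e2, e3, sub_le_iff_le_add, ← spectralSum_const_mul, ← spectralSum_const_mul,
    ← spectralSum_add]
  exact spectralSum_mono hX hZ 1 fun x z hx hz => one_add_mul_le_rpow_neg_add hp hx hz

theorem continuousOn_spectrum_real {X : Matrix m m ℂ} (f : ℝ → ℝ) :
    ContinuousOn f (spectrum ℝ X) :=
  (finite_real_spectrum (A := X)).continuousOn f

theorem PosDef.spectrum_pos {X : Matrix m m ℂ} (hX : X.PosDef) {x : ℝ} (hx : x ∈ spectrum ℝ X) :
    0 < x := by
  rw [hX.1.spectrum_real_eq_range_eigenvalues] at hx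
  obtain ⟨i, rfl⟩ := hx
  exact hX.eigenvalues_pos i

theorem PosDef.cfc {X : Matrix m m ℂ} (hX : X.PosDef) {f : ℝ → ℝ} (hf : ∀ x, 0 < x → 0 < f x) :
    (cfc f X).PosDef := by
  have hH : (_root_.cfc f X).IsHermitian := cfc_predicate f X
  rw [hH.posDef_iff_eigenvalues_pos]
  intro i
  have := hH.eigenvalues_mem_spectrum_real i
  rw [cfc_map_spectrum f X hX.1.isSelfAdjoint (continuousOn_spectrum_real f)] at this
  obtain ⟨x, hx, hxe⟩ := this
  rw [← hxe]
  exact hf x (hX.spectrum_pos hx)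

/-- The bound `re_trace_le_re_trace_cfc_rpow_neg` is attained. -/
theorem re_trace_cfc_rpow_neg_eq {X : Matrix m m ℂ} (hX : X.PosDef) {p : ℝ} (hp : 0 < p) :
    (trace (cfc (fun x : ℝ => x ^ (-p⁻¹)) X)).re =
      (1 + p⁻¹) * (trace (cfc (fun x : ℝ => x ^ (-p⁻¹)) X)).re - p⁻¹ * (trace (X *
        cfc (fun z : ℝ => z ^ (1 + p)) (cfc (fun x : ℝ => x ^ (-p⁻¹)) X))).re := by
  -- At the maximizer `Z = X^(-1/p)`, the exponents satisfy `1 - (1 + p)/p = -1/p`.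
  have e : X * cfc (fun z : ℝ => z ^ (1 + p)) (cfc (fun x : ℝ => x ^ (-p⁻¹)) X) =
      cfc (fun x : ℝ => x ^ (-p⁻¹)) X := by
    rw [← cfc_comp' (fun z : ℝ => z ^ (1 + p)) (fun x : ℝ => x ^ (-p⁻¹)) X
      ((finite_real_spectrum.image _).continuousOn _) (continuousOn_spectrum_real _)
      hX.1.isSelfAdjoint]
    nth_rw 1 [← cfc_id' ℝ X hX.1.isSelfAdjoint]
    rw [← cfc_mul _ _ X (continuousOn_spectrum_real _) (continuousOn_spectrum_real _)]
    refine cfc_congr fun x hx => ?_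
    have hx := hX.spectrum_pos hx
    have e1 : -p⁻¹ * (1 + p) = -p⁻¹ - 1 := by field_simp; ring
    rw [← Real.rpow_mul hx.le, e1, Real.rpow_sub_one hx.ne']
    field_simp
  rw [e]
  ring

/-- The normalization makes the `H i` jointly injective: if every `H i` kills `x`, then `x = ∑ (H
i)ᴴ (H i) x = 0`. -/
theorem posDef_sum_conjTranspose_mul_mul {ι : Type*} [Fintype ι] {n : ι → Type*}
    [∀ i, Fintype (n i)] {H : ∀ i, Matrix (n i) m ℂ} (hH : ∑ i, (H i)ᴴ * H i = 1)
    {B : ∀ i, Matrix (n i) (n i) ℂ} (hB : ∀ i, (B i).PosDef) :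
    (∑ i, (H i)ᴴ * B i * H i).PosDef := by
  have hs : ∀ i ∈ Finset.univ, ((H i)ᴴ * B i * H i).PosSemidef := fun i _ =>
    (hB i).posSemidef.conjTranspose_mul_mul_same (H i)
  refine .of_dotProduct_mulVec_pos (posSemidef_sum _ hs).1 fun {x} hx => ?_
  have hterm : ∀ i, star x ⬝ᵥ ((H i)ᴴ * B i * H i) *ᵥ x =
      star (H i *ᵥ x) ⬝ᵥ B i *ᵥ (H i *ᵥ x) := fun i => by
    simp only [star_mulVec, dotProduct_mulVec, vecMul_vecMul, Matrix.mul_assoc]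
  rw [sum_mulVec, dotProduct_sum]
  refine Finset.sum_pos' (fun i hi => (hs i hi).dotProduct_mulVec_nonneg x) ?_
  by_contra! h
  refine hx ?_
  have h0 : ∀ i, H i *ᵥ x = 0 := fun i => by
    by_contra hne
    refine h i (Finset.mem_univ i) ?_
    rw [hterm]
    exact (hB i).dotProduct_mulVec_pos hne
  rw [← one_mulVec x, ← hH, sum_mulVec]
  exact Finset.sum_eq_zero fun i _ => by rw [← mulVec_mulVec, h0, mulVec_zero]

theorem posDef_add_smul {n : Type*} {A B : Matrix n n ℂ} (hA : A.PosDef) (hB : B.PosDef) {u v : ℝ}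
    (hu : 0 ≤ u) (hv : 0 ≤ v) (huv : u + v = 1) : (u • A + v • B).PosDef := by
  rcases hu.eq_or_lt with rfl | hu
  · obtain rfl : v = 1 := by linarith
    simpa using hB
  · exact (hA.smul hu).add_posSemidef (hB.posSemidef.smul hv)

/-! ### The trace function of the deformed logarithm -/

section QLog

variable {k : ℕ} {n : Fin k → Type*} [∀ i, Fintype (n i)] [∀ i, DecidableEq (n i)]

theorem isHermitian_qLogSum {m : Type*} (q : ℝ) (H : ∀ i, Matrix (n i) m ℂ)
    (A : ∀ i, Matrix (n i) (n i) ℂ) : (qLogSum q H A).IsHermitian := by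
  unfold qLogSum IsHermitian
  rw [conjTranspose_sum]
  refine Finset.sum_congr rfl fun i _ => ?_
  have h : (cfc (qLog q) (A i))ᴴ = cfc (qLog q) (A i) := cfc_predicate (qLog q) (A i)
  rw [conjTranspose_mul, conjTranspose_mul, conjTranspose_conjTranspose, h, Matrix.mul_assoc]

/-- The affine map turns `log_q x` into `x^(q-1)`; its constant term commutes with the sum because
`∑ H_i^* H_i = 1`. -/
theorem cfc_affine_qLogSum {H : ∀ i, Matrix (n i) m ℂ} (hH : ∑ i, (H i)ᴴ * H i = 1)
    {q : ℝ} (hq1 : q < 1) {A : ∀ i, Matrix (n i) (n i) ℂ} (hA : ∀ i, (A i).PosDef) :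
    cfc (fun x : ℝ => x * (q - 1) + 1) (qLogSum q H A) =
      ∑ i, (H i)ᴴ * cfc (fun x : ℝ => x ^ (-(1 - q))) (A i) * H i := by
  have hL := (isHermitian_qLogSum q H A).isSelfAdjoint
  have e : ∀ i, cfc (fun x : ℝ => x ^ (-(1 - q))) (A i) =
      (q - 1) • cfc (qLog q) (A i) + 1 := fun i => by
    rw [← cfc_const_one ℝ (A i) (hA i).1.isSelfAdjoint,
      ← cfc_smul (q - 1) (qLog q) (A i) (continuousOn_spectrum_real _),
      ← cfc_add (A i) _ _ (continuousOn_spectrum_real _) (continuousOn_spectrum_real _)]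
    refine cfc_congr fun x _ => ?_
    have : q - 1 ≠ 0 := by linarith
    simp only [qLog, hq1.ne, if_false, smul_eq_mul, neg_sub]
    field_simp
    ring
  rw [cfc_add_const (1 : ℝ) (fun x : ℝ => x * (q - 1)) (qLogSum q H A)
    (continuousOn_spectrum_real _) hL]
  simp_rw [mul_comm _ (q - 1)]
  rw [cfc_const_mul_id (q - 1) (qLogSum q H A) hL, map_one, ← hH, qLogSum, Finset.smul_sum,
    ← Finset.sum_add_distrib]
  refine Finset.sum_congr rfl fun i _ => ?_
  rw [e, Matrix.mul_add, Matrix.add_mul, Matrix.mul_smul, Matrix.smul_mul, Matrix.mul_one]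

/-- Membership in the domain means `x (q - 1) + 1 > 0`, which is positivity of the spectrum of `∑
H_i^* A_i^(q-1) H_i`. -/
theorem spectrum_qLogSum {H : ∀ i, Matrix (n i) m ℂ} (hH : ∑ i, (H i)ᴴ * H i = 1)
    {q : ℝ} (hq1 : q < 1) {A : ∀ i, Matrix (n i) (n i) ℂ} (hA : ∀ i, (A i).PosDef) :
    spectrum ℝ (qLogSum q H A) ⊆ qExpDomain q := by
  intro x hx
  refine ⟨fun h => absurd h hq1.not_gt, fun _ => ?_⟩
  have hX := posDef_sum_conjTranspose_mul_mul hH fun i =>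
    (hA i).cfc (f := fun x : ℝ => x ^ (-(1 - q))) fun x hx => Real.rpow_pos_of_pos hx _
  rw [← cfc_affine_qLogSum hH hq1 hA] at hX
  have h : 0 < x * (q - 1) + 1 := hX.spectrum_pos <| by
    rw [cfc_map_spectrum (fun x : ℝ => x * (q - 1) + 1) (qLogSum q H A)
      (isHermitian_qLogSum q H A).isSelfAdjoint (continuousOn_spectrum_real _)]
    exact ⟨x, hx, rfl⟩
  rw [lt_div_iff_of_neg (by linarith)]
  linarith

theorem qTraceFun_eq {H : ∀ i, Matrix (n i) m ℂ} (hH : ∑ i, (H i)ᴴ * H i = 1)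
    {q : ℝ} (hq1 : q < 1) {A : ∀ i, Matrix (n i) (n i) ℂ} (hA : ∀ i, (A i).PosDef) :
    qTraceFun q H A = (trace (cfc (fun x : ℝ => x ^ (-(1 - q)⁻¹))
      (∑ i, (H i)ᴴ * cfc (fun x : ℝ => x ^ (-(1 - q))) (A i) * H i))).re := by
  rw [← cfc_affine_qLogSum hH hq1 hA, ← cfc_comp' (fun x : ℝ => x ^ (-(1 - q)⁻¹))
    (fun x : ℝ => x * (q - 1) + 1) (qLogSum q H A)
    ((finite_real_spectrum.image _).continuousOn _) (continuousOn_spectrum_real _)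
    (isHermitian_qLogSum q H A).isSelfAdjoint, qTraceFun]
  have e : 1 / (q - 1) = -(1 - q)⁻¹ := by rw [one_div, ← inv_neg, neg_sub]
  congr 3
  funext x
  simp only [qExp, hq1.ne, if_false, e]

/-- The functional whose maximum over `Z` is the trace function. -/
noncomputable def traceMinorant (p : ℝ) (H : ∀ i, Matrix (n i) m ℂ)
    (A : ∀ i, Matrix (n i) (n i) ℂ) (Z : Matrix m m ℂ) : ℝ :=
  (1 + p⁻¹) * (trace Z).re - p⁻¹ * (trace
    ((∑ i, (H i)ᴴ * cfc (fun x : ℝ => x ^ (-p)) (A i) * H i) *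
      cfc (fun z : ℝ => z ^ (1 + p)) Z)).re

theorem traceMinorant_eq (p : ℝ) (H : ∀ i, Matrix (n i) m ℂ)
    {A : ∀ i, Matrix (n i) (n i) ℂ} (hA : ∀ i, (A i).PosDef) {Z : Matrix m m ℂ} (hZ : Z.PosDef) :
    traceMinorant p H A Z = (1 + p⁻¹) * (trace Z).re -
      p⁻¹ * ∑ i, spectralSum (hA i).1 hZ.1 (H i) fun a z => a ^ (-p) * z ^ (1 + p) := by
  rw [traceMinorant, Finset.sum_mul, trace_sum, Complex.re_sum]
  congr 2
  refine Finset.sum_congr rfl fun i _ => ?_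
  rw [← re_trace_conjTranspose_mul_cfc_mul_cfc (hA i).1 hZ.1 (H i) (fun x : ℝ => x ^ (-p))
    (fun z : ℝ => z ^ (1 + p))]
  simp only [Matrix.mul_assoc]

theorem traceMinorant_concave {p : ℝ} (hp0 : 0 < p) (hp1 : p ≤ 1) (H : ∀ i, Matrix (n i) m ℂ)
    {A B : ∀ i, Matrix (n i) (n i) ℂ} (hA : ∀ i, (A i).PosDef) (hB : ∀ i, (B i).PosDef)
    {Z Y : Matrix m m ℂ} (hZ : Z.PosDef) (hY : Y.PosDef)
    {u v : ℝ} (hu : 0 ≤ u) (hv : 0 ≤ v) (huv : u + v = 1) :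
    u * traceMinorant p H A Z + v * traceMinorant p H B Y ≤
      traceMinorant p H (u • A + v • B) (u • Z + v • Y) := by
  have hAB : ∀ i, ((u • A + v • B) i).PosDef := fun i => posDef_add_smul (hA i) (hB i) hu hv huv
  have hZY := posDef_add_smul hZ hY hu hv huv
  rw [traceMinorant_eq p H hA hZ, traceMinorant_eq p H hB hY, traceMinorant_eq p H hAB hZY,
    trace_add, trace_smul, trace_smul, Complex.add_re, Complex.real_smul, Complex.real_smul,
    Complex.re_ofReal_mul, Complex.re_ofReal_mul]
  have h := Finset.sum_le_sum fun i (_ : i ∈ Finset.univ) =>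
    spectralSum_rpow_convex (hA i) (hB i) hZ hY hp0 hp1 hu hv (hAB i) hZY (H i)
  rw [Finset.sum_add_distrib, ← Finset.mul_sum, ← Finset.mul_sum] at h
  have h' := mul_le_mul_of_nonneg_left h (inv_nonneg.2 hp0.le)
  linarith

theorem concaveOn_qTraceFun {H : ∀ i, Matrix (n i) m ℂ} (hH : ∑ i, (H i)ᴴ * H i = 1)
    {q : ℝ} (hq0 : 0 ≤ q) (hq1 : q < 1) :
    ConcaveOn ℝ {A : ∀ i, Matrix (n i) (n i) ℂ | ∀ i, (A i).PosDef} (qTraceFun q H) := by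
  have hp0 : 0 < 1 - q := by linarith
  have hX : ∀ {A : ∀ i, Matrix (n i) (n i) ℂ}, (∀ i, (A i).PosDef) →
      (∑ i, (H i)ᴴ * cfc (fun x : ℝ => x ^ (-(1 - q))) (A i) * H i).PosDef := fun hA =>
    posDef_sum_conjTranspose_mul_mul hH fun i =>
      (hA i).cfc fun x hx => Real.rpow_pos_of_pos hx _
  have hmax : ∀ {A : ∀ i, Matrix (n i) (n i) ℂ}, (∀ i, (A i).PosDef) →
      ∃ Z, Z.PosDef ∧ qTraceFun q H A = traceMinorant (1 - q) H A Z := fun hA =>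
    ⟨_, (hX hA).cfc fun x hx => Real.rpow_pos_of_pos hx _,
      (qTraceFun_eq hH hq1 hA).trans (re_trace_cfc_rpow_neg_eq (hX hA) hp0)⟩
  have hconv : Convex ℝ {A : ∀ i, Matrix (n i) (n i) ℂ | ∀ i, (A i).PosDef} :=
    fun A hA B hB u v hu hv huv i => posDef_add_smul (hA i) (hB i) hu hv huv
  refine ⟨hconv, fun A hA B hB u v hu hv huv => ?_⟩
  have hAB := hconv hA hB hu hv huv
  -- `Z` and `Y` are optimal for `A` and `B`; `u • Z + v • Y` need only be a competitor for `u • A +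
  -- v • B`.
  obtain ⟨Z, hZ, hAZ⟩ := hmax hA
  obtain ⟨Y, hY, hBY⟩ := hmax hB
  rw [hAZ, hBY, qTraceFun_eq hH hq1 hAB]
  exact (traceMinorant_concave hp0 (by linarith) H hA hB hZ hY hu hv huv).trans
    (re_trace_le_re_trace_cfc_rpow_neg (hX hAB) (posDef_add_smul hZ hY hu hv huv) hp0)

end QLog

end Matrix

theorem corollary5p1 {k : ℕ} {n : Fin k → Type*} {m : Type*}
    [∀ i, Fintype (n i)] [∀ i, DecidableEq (n i)] [Fintype m] [DecidableEq m]
    (H : ∀ i, Matrix (n i) m ℂ) (hH : ∑ i, (H i)ᴴ * H i = 1)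
    (q : ℝ) (hq0 : 0 ≤ q) (hq1 : q < 1) :
    (∀ A : ∀ i, Matrix (n i) (n i) ℂ, (∀ i, (A i).PosDef) →
      (qLogSum q H A).IsHermitian ∧ spectrum ℝ (qLogSum q H A) ⊆ qExpDomain q) ∧
    ConcaveOn ℝ {A : ∀ i, Matrix (n i) (n i) ℂ | ∀ i, (A i).PosDef} (qTraceFun q H) :=
  ⟨fun A hA => ⟨Matrix.isHermitian_qLogSum q H A, Matrix.spectrum_qLogSum hH hq1 hA⟩,
    Matrix.concaveOn_qTraceFun hH hq0 hq1⟩
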